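/- Let $R$ be an associative ring with unit and let $M$ be a left $R$-module. The category $\sigma[M]$ is the full subcategory of left $R$-modules whose objects are the modules isomorphic to a submodule of a quotient of a direct sum of copies of $M$. A submodule $N\le M$ is fully invariant if $f(N)\le N$ for all $f\in \mathrm{End}_R(M)$. For submodules $K,L\le M$ put $K_ML=\sum\{f(K)\mid f\in \mathrm{Hom}_R(M,L)\}$. A fully invariant submodule $N\le M$ is prime in $M$ if for all fully invariant submodules $K,L\le M$, $K_ML\le N$ implies $K\le N$ or $L\le N$; a minimal prime submodule of $M$ is a minimal element of the set of prime submodules in $M$. The module $M$ is semiprime if for every fully invariant $K\le M$, $K_MK=0$ implies $K=0$. A module $X$ has finite uniform dimension if it contains no infinite direct sum of nonzero submodules. A left annihilator in $X$ is a submodule $\bigcap_{f\in F}\ker f$ with $F\subseteq \mathrm{End}_R(X)$, and $X$ is a Goldie module if it satisfies the ascending chain condition on left annihilators and has finite uniform dimension. Proposition. Let $M$ be semiprime and projective in $\sigma[M]$, with finitely many minimal prime submodules $P_1,\dots,P_t$. Suppose that every quotient $M/P_i$ $(1\le i\le t)$ has finite uniform dimension. Then $M$ is a Goldie module if and only if each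 $M/P_i$ $(1\le i\le t)$ is a Goldie module. -/

import Mathlib

universe u v

section Sigma

variable (R : Type u) [Ring R] (M : Type v) [AddCommGroup M] [Module R M]

/-- `X` is `M`-generated: there is an epimorphism onto `X` from a direct sum of copies of `M`. -/
def IsModGenerated (X : Type v) [AddCommGroup X] [Module R X] : Prop :=
  ∃ (ι : Type v) (p : (ι →₀ M) →ₗ[R] X), Function.Surjective p

/-- `X` is an object of `σ[M]`: it is isomorphic to a submodule of an `M`-generated module.
The universe `v` loses nothing: each element of `X` involves only finitely many copies of `M`. -/
def InSigma (X : Type v) [AddCommGroup X] [Module R X] : Prop :=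
  ∃ (Y : Type v) (_ : AddCommGroup Y) (_ : Module R Y),
    IsModGenerated R M Y ∧ ∃ g : X →ₗ[R] Y, Function.Injective g

/-- `M` is projective in the category `σ[M]`. Epimorphisms in `σ[M]` are the surjective maps,
since `σ[M]` is closed under quotients. It suffices to test on modules in the universe of `M`:
a lifting problem can be replaced by one in which `A` is generated by a family indexed by `M`,
and `R` acts on objects of `σ[M]` through its image in `End M`. -/
def IsProjectiveInSigma : Prop :=
  ∀ (A B : Type v) [AddCommGroup A] [Module R A] [AddCommGroup B] [Module R B],
    InSigma R M A → InSigma R M B →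
    ∀ (g : A →ₗ[R] B) (f : M →ₗ[R] B), Function.Surjective g →
      ∃ h : M →ₗ[R] A, g ∘ₗ h = f

end Sigma

section Primes

variable {R : Type u} [Ring R] {M : Type v} [AddCommGroup M] [Module R M]

/-- The product `K_M L = ∑ {f(K) | f ∈ Hom_R(M, L)}`, as a submodule of `M`. -/
def subProd (K L : Submodule R M) : Submodule R M :=
  ⨆ f : M →ₗ[R] L, K.map (L.subtype ∘ₗ f)

/-- `N` is a prime submodule in `M`. The submodule `N = M` is not excluded; it is never a
*minimal* prime submodule of a nonzero semiprime module that is projective in `σ[M]`. -/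
def IsPrimeSub (N : Submodule R M) : Prop :=
  N.IsFullyInvariant ∧ ∀ K L : Submodule R M, K.IsFullyInvariant → L.IsFullyInvariant →
    subProd K L ≤ N → K ≤ N ∨ L ≤ N

/-- `N` is a semiprime submodule in `M`. -/
def IsSemiprimeSub (N : Submodule R M) : Prop :=
  N.IsFullyInvariant ∧ ∀ K : Submodule R M, K.IsFullyInvariant → subProd K K ≤ N → K ≤ N

/-- `N` is a minimal prime submodule in `M`: a minimal element among the prime submodules. -/
def IsMinimalPrimeSub (N : Submodule R M) : Prop :=
  Minimal IsPrimeSub N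

/-- A left annihilator in `M`: a submodule `⋂ {Ker f | f ∈ X}` with `X ⊆ End_R(M)`. -/
def IsLeftAnnihilator (N : Submodule R M) : Prop :=
  ∃ X : Set (M →ₗ[R] M), N = ⨅ f ∈ X, LinearMap.ker f

end Primes

section Goldie

variable (R : Type u) [Ring R] (M : Type v) [AddCommGroup M] [Module R M]

/-- `M` is a semiprime module: `0` is a semiprime submodule in `M`. -/
def IsSemiprimeModule : Prop :=
  IsSemiprimeSub (⊥ : Submodule R M)

/-- `M` has finite uniform dimension: there is no infinite independent family (infinite direct
sum) of nonzero submodules of `M`. -/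
def HasFiniteUniformDim : Prop :=
  ¬ ∃ N : ℕ → Submodule R M, (∀ n, N n ≠ ⊥) ∧ iSupIndep N

/-- The ascending chain condition on left annihilators in `M`. -/
def ACCLeftAnnihilators : Prop :=
  ∀ a : ℕ → Submodule R M, Monotone a → (∀ n, IsLeftAnnihilator (a n)) →
    ∃ n, ∀ m, n ≤ m → a m = a n

/-- `M` is a Goldie module. -/
def IsGoldieModule : Prop :=
  ACCLeftAnnihilators R M ∧ HasFiniteUniformDim R M

end Goldie

/-! ### Uniform dimension of finite subdirect products. -/

section UniformDimension

variable {R : Type*} [Ring R]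

/-! The minimal primes intersect in zero (`iInf_minimalPrimeSub_eq_bot`), so `M` embeds in the
finite product of the `M ⧸ P i`. Uniform dimension and the chain condition therefore pass up from
the quotients. Conversely, let `L` be the intersection of the minimal primes other than `Q = P i ≠
⊤`. Then `L ⊓ Q = ⊥`, and minimality gives `¬ L ≤ Q`, so `Q` is exactly what all maps `M → L` kill.
Lifting endomorphisms of `M ⧸ Q` by projectivity, preimages of left annihilators in `M ⧸ Q` are left
annihilators in `M`. -/

theorem iSupIndep_map_of_disjoint_ker {ι X Y : Type*} [AddCommGroup X] [Module R X]
    [AddCommGroup Y] [Module R Y] (f : X →ₗ[R] Y) {N : ι → Submodule R X} (hN : iSupIndep N)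
    (h : ∀ s : Finset ι, Disjoint (⨆ i ∈ s, N i) (LinearMap.ker f)) :
    iSupIndep fun i => (N i).map f := by
  rw [iSupIndep_iff_finsetSum_eq_zero_imp_eq_zero] at hN ⊢
  intro s v hv hsum i hi
  choose! w hw hwv using hv
  have hmem : ∑ i ∈ s, w i ∈ ⨆ i ∈ s, N i :=
    Submodule.sum_mem _ fun j hj => Submodule.mem_iSup_of_mem j (Submodule.mem_iSup_of_mem hj (hw j hj))
  have hker : ∑ i ∈ s, w i ∈ LinearMap.ker f := by
    rw [LinearMap.mem_ker, map_sum, ← hsum]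
    exact Finset.sum_congr rfl hwv
  have hzero := (Submodule.disjoint_def.mp (h s)) _ hmem hker
  rw [← hwv i hi, hN s w hw hzero i hi, map_zero]

theorem iSupIndep_blocks {ι κ α : Type*} [CompleteLattice α] [IsModularLattice α]
    [IsCompactlyGenerated α] {N : ι → α} (hN : iSupIndep N) {S : κ → Set ι}
    (hS : Pairwise fun j k => Disjoint (S j) (S k)) :
    iSupIndep fun k => ⨆ i ∈ S k, N i := by
  intro k
  refine (hN.disjoint_biSup_biSup (s := S k) (t := (S k)ᶜ) disjoint_compl_right).mono_right ?_
  refine iSup₂_le fun j hj => iSup₂_le fun i hi => ?_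
  exact le_biSup N (Set.disjoint_left.mp (hS hj) hi)

/-- Either infinitely many disjoint blocks of the direct sum meet `ker f`, and these intersections
embed in `Z` by `g`; or some tail misses `ker f` and embeds in `Y`. -/
theorem HasFiniteUniformDim.of_ker_inf_eq_bot {X Y Z : Type*} [AddCommGroup X] [Module R X]
    [AddCommGroup Y] [Module R Y] [AddCommGroup Z] [Module R Z]
    (f : X →ₗ[R] Y) (g : X →ₗ[R] Z) (hfg : Disjoint (LinearMap.ker f) (LinearMap.ker g))
    (hY : HasFiniteUniformDim R Y) (hZ : HasFiniteUniformDim R Z) :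
    HasFiniteUniformDim R X := by
  rintro ⟨N, hne, hind⟩
  by_cases hblock : ∀ m, ∃ n, m ≤ n ∧
      ¬ Disjoint (⨆ i ∈ Set.Ico m n, N i) (LinearMap.ker f)
  · choose next hle hnext using hblock
    let φ : ℕ → ℕ := fun k => next^[k] 0
    have hφ : ∀ k, φ (k + 1) = next (φ k) := fun k => Function.iterate_succ_apply' next k 0
    have hmono : Monotone φ := monotone_nat_of_le_succ fun k => by
      rw [hφ]; exact hle _
    let W : ℕ → Submodule R X := fun k =>
      (⨆ i ∈ Set.Ico (φ k) (φ (k + 1)), N i) ⊓ LinearMap.ker f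
    have hWker : ∀ k, W k ≤ LinearMap.ker f := fun k => inf_le_right
    have hW : iSupIndep W :=
      (iSupIndep_blocks hind (S := fun k => Set.Ico (φ k) (φ (k + 1)))
        hmono.pairwise_disjoint_on_Ico_succ).mono fun k => inf_le_left
    refine hZ ⟨fun k => (W k).map g, fun k hk => ?_, ?_⟩
    · have hWk : W k = ⊥ :=
        le_bot_iff.mp (hfg (hWker k) (LinearMap.le_ker_iff_map.mpr hk))
      refine hnext (φ k) ?_
      rw [disjoint_iff, ← hφ]
      exact hWk
    · exact iSupIndep_map_of_disjoint_ker g hW fun s =>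
        hfg.mono_left (iSup₂_le fun i _ => hWker i)
  · push Not at hblock
    obtain ⟨m, hm⟩ := hblock
    have hdis : ∀ s : Finset ℕ, Disjoint (⨆ i ∈ s, N (m + i)) (LinearMap.ker f) := fun s => by
      refine (hm (m + (s.sup id + 1)) (by omega)).mono_left (iSup₂_le fun i hi => ?_)
      refine le_biSup N (i := m + i) ⟨by omega, ?_⟩
      have : i ≤ s.sup id := Finset.le_sup (f := id) hi
      omega
    refine hY ⟨fun i => (N (m + i)).map f, fun i hi => ?_, ?_⟩
    · have := hdis {i}
      rw [Finset.iSup_singleton] at this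
      exact hne (m + i) (le_bot_iff.mp (this le_rfl (LinearMap.le_ker_iff_map.mpr hi)))
    · exact iSupIndep_map_of_disjoint_ker f (hind.comp (add_right_injective m)) hdis

theorem HasFiniteUniformDim.of_subsingleton {X : Type*} [AddCommGroup X] [Module R X]
    [Subsingleton X] : HasFiniteUniformDim R X := by
  rintro ⟨N, hne, -⟩
  exact hne 0 (Subsingleton.elim _ _)

theorem HasFiniteUniformDim.quotient_finset_inf {ι X : Type*} [AddCommGroup X] [Module R X]
    (P : ι → Submodule R X) (h : ∀ i, HasFiniteUniformDim R (X ⧸ P i)) (s : Finset ι) :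
    HasFiniteUniformDim R (X ⧸ s.inf P) := by
  classical
  induction s using Finset.induction_on with
  | empty =>
    have : Subsingleton (X ⧸ (∅ : Finset ι).inf P) := by
      rw [Submodule.Quotient.subsingleton_iff, Finset.inf_empty]
    exact HasFiniteUniformDim.of_subsingleton
  | insert a s _ ih =>
    rw [Finset.inf_insert]
    refine HasFiniteUniformDim.of_ker_inf_eq_bot
      (Submodule.factor (inf_le_left : P a ⊓ s.inf P ≤ P a))
      (Submodule.factor (inf_le_right : P a ⊓ s.inf P ≤ s.inf P)) ?_ (h a) ih
    rw [Submodule.disjoint_def]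
    intro x
    obtain ⟨x, rfl⟩ := Submodule.mkQ_surjective _ x
    intro h₁ h₂
    rw [LinearMap.mem_ker, Submodule.factor_mk, Submodule.mkQ_apply,
      Submodule.Quotient.mk_eq_zero] at h₁ h₂
    exact (Submodule.Quotient.mk_eq_zero _).mpr ⟨h₁, h₂⟩

end UniformDimension

/-! ### Lifting endomorphisms by projectivity. -/

section InSigma

variable {R : Type u} [Ring R] {M : Type v} [AddCommGroup M] [Module R M]

theorem InSigma.submodule_finsupp {ι : Type v} (N : Submodule R (ι →₀ M)) : InSigma R M N :=
  ⟨ι →₀ M, inferInstance, inferInstance, ⟨ι, LinearMap.id, Function.surjective_id⟩,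
    N.subtype, N.injective_subtype⟩

theorem InSigma.of_surjective {X : Type v} [AddCommGroup X] [Module R X] (p : M →ₗ[R] X)
    (hp : Function.Surjective p) : InSigma R M X := by
  refine ⟨X, inferInstance, inferInstance,
    ⟨PUnit, Finsupp.lsum ℕ fun _ => p, fun x => ?_⟩, LinearMap.id, Function.injective_id⟩
  obtain ⟨m, rfl⟩ := hp x
  exact ⟨Finsupp.single PUnit.unit m, by simp⟩

theorem InSigma.submodule (N : Submodule R M) : InSigma R M N := by
  obtain ⟨Y, i₁, i₂, hY, g, hg⟩ := InSigma.of_surjective (LinearMap.id (R := R) (M := M))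
    Function.surjective_id
  exact ⟨Y, i₁, i₂, hY, g ∘ₗ N.subtype, hg.comp N.injective_subtype⟩

/-- An endomorphism with image in `∑ hᵢ(Nᵢ)` decomposes as `∑ hᵢ gᵢ` with `gᵢ` mapping to `Nᵢ`. -/
theorem IsProjectiveInSigma.exists_decomposition (hproj : IsProjectiveInSigma R M) {ι : Type v}
    (N : ι → Submodule R M) (h : ι → M →ₗ[R] M) (f : M →ₗ[R] M)
    (hf : ∀ m, f m ∈ ⨆ i, (N i).map (h i)) :
    ∃ g : M →ₗ[R] (ι →₀ M), (∀ m i, g m i ∈ N i) ∧ ∀ m, f m = (g m).sum fun i x => h i x := by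
  -- `A` is `⨁ Nᵢ`; `f` is lifted along its surjection onto `∑ hᵢ(Nᵢ)`.
  let A : Submodule R (ι →₀ M) := ⨅ i, (N i).comap (Finsupp.lapply i)
  have hA : ∀ x : ι →₀ M, x ∈ A ↔ ∀ i, x i ∈ N i := fun x => by simp [A]
  let p : (ι →₀ M) →ₗ[R] M := Finsupp.lsum ℕ h
  have hp : ∀ x, p x = x.sum fun i x => h i x := fun x => rfl
  have hpA : ∀ x ∈ A, p x ∈ ⨆ i, (N i).map (h i) := fun x hx =>
    Submodule.sum_mem _ fun i _ =>
      Submodule.mem_iSup_of_mem i (Submodule.mem_map_of_mem ((hA x).mp hx i))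
  have hsub : (⨆ i, (N i).map (h i)) ≤ A.map p := by
    classical
    refine iSup_le fun i => ?_
    rintro _ ⟨n, hn, rfl⟩
    refine ⟨Finsupp.single i n, (hA _).mpr fun j => ?_, by simp [p]⟩
    by_cases hij : i = j
    · subst hij; simpa using hn
    · rw [Finsupp.single_eq_of_ne (Ne.symm hij)]; exact zero_mem _
  obtain ⟨g, hg⟩ := hproj A ↥(⨆ i, (N i).map (h i)) (InSigma.submodule_finsupp A)
    (InSigma.submodule _) (p.restrict hpA) (f.codRestrict _ hf) (by
      rintro ⟨y, hy⟩
      obtain ⟨x, hx, rfl⟩ := hsub hy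
      exact ⟨⟨x, hx⟩, rfl⟩)
  refine ⟨A.subtype ∘ₗ g, fun m => (hA _).mp (g m).2, fun m => ?_⟩
  exact congrArg Subtype.val (LinearMap.congr_fun hg m).symm

theorem IsProjectiveInSigma.exists_add_of_mem_sup (hproj : IsProjectiveInSigma R M)
    (K L : Submodule R M) (f : M →ₗ[R] M) (hf : ∀ m, f m ∈ K ⊔ L) :
    ∃ g h : M →ₗ[R] M, (∀ m, g m ∈ K) ∧ (∀ m, h m ∈ L) ∧ f = g + h := by
  obtain ⟨g, hg, hsum⟩ := hproj.exists_decomposition (ι := ULift.{v} Bool)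
    (fun i => if i.down then K else L) (fun _ => LinearMap.id) f (fun m => by
      refine (sup_le ?_ ?_ : K ⊔ L ≤ _) (hf m)
      · exact le_iSup_of_le ⟨true⟩ (by simp)
      · exact le_iSup_of_le ⟨false⟩ (by simp))
  refine ⟨Finsupp.lapply ⟨true⟩ ∘ₗ g, Finsupp.lapply ⟨false⟩ ∘ₗ g,
    fun m => by simpa using hg m ⟨true⟩, fun m => by simpa using hg m ⟨false⟩, ?_⟩
  ext m
  rw [hsum, Finsupp.sum_fintype _ _ (by simp), ← Equiv.ulift.symm.sum_comp]
  simp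

theorem IsProjectiveInSigma.exists_lift_quotient (hproj : IsProjectiveInSigma R M)
    (N : Submodule R M) (f : M ⧸ N →ₗ[R] M ⧸ N) :
    ∃ g : M →ₗ[R] M, ∀ m, N.mkQ (g m) = f (N.mkQ m) := by
  obtain ⟨g, hg⟩ := hproj M (M ⧸ N)
    (InSigma.of_surjective LinearMap.id Function.surjective_id)
    (InSigma.of_surjective N.mkQ N.mkQ_surjective) N.mkQ (f ∘ₗ N.mkQ) N.mkQ_surjective
  exact ⟨g, LinearMap.congr_fun hg⟩

end InSigma

/-! ### Existence and intersection of minimal primes. -/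

section Primes

variable {R : Type u} [Ring R] {M : Type v} [AddCommGroup M] [Module R M]

theorem subProd_le_iff {K L N : Submodule R M} :
    subProd K L ≤ N ↔ ∀ f : M →ₗ[R] M, (∀ m, f m ∈ L) → ∀ k ∈ K, f k ∈ N := by
  constructor
  · intro h f hf k hk
    exact h (Submodule.mem_iSup_of_mem (f.codRestrict L hf) ⟨k, hk, rfl⟩)
  · intro h
    refine iSup_le fun f => ?_
    rintro _ ⟨k, hk, rfl⟩
    exact h (L.subtype ∘ₗ f) (fun m => (f m).2) k hk

/-- The fully invariant submodule generated by `N`. -/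
def invariantClosure (N : Submodule R M) : Submodule R M :=
  ⨆ h : M →ₗ[R] M, N.map h

theorem apply_mem_invariantClosure {N : Submodule R M} (h : M →ₗ[R] M) {n : M} (hn : n ∈ N) :
    h n ∈ invariantClosure N :=
  Submodule.mem_iSup_of_mem h ⟨n, hn, rfl⟩

theorem le_invariantClosure (N : Submodule R M) : N ≤ invariantClosure N :=
  fun _ hn => apply_mem_invariantClosure LinearMap.id hn

theorem invariantClosure_isFullyInvariant (N : Submodule R M) :
    (invariantClosure N).IsFullyInvariant := by
  intro f
  refine iSup_le fun h => ?_
  rintro _ ⟨n, hn, rfl⟩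
  exact apply_mem_invariantClosure (f ∘ₗ h) hn

theorem invariantClosure_le_comap {N L : Submodule R M} {f : M →ₗ[R] M}
    (h : ∀ g : M →ₗ[R] M, ∀ n ∈ N, f (g n) ∈ L) : invariantClosure N ≤ L.comap f := by
  refine iSup_le fun g => ?_
  rintro _ ⟨n, hn, rfl⟩
  exact h g n hn

/-- Otherwise the fully invariant closure `K` of `R ∙ x` has `K_M K = 0`: a map into `K` is a sum of
`hᵢ gᵢ` with `gᵢ` into `R ∙ x`, and every `gᵢ h` kills `x`. -/
theorem IsSemiprimeModule.exists_apply_ne_zero (hsemi : IsSemiprimeModule R M)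
    (hproj : IsProjectiveInSigma R M) {x : M} (hx : x ≠ 0) :
    ∃ f : M →ₗ[R] M, (∀ m, f m ∈ R ∙ x) ∧ f x ≠ 0 := by
  by_contra! hcon
  have hzero : ∀ f : M →ₗ[R] M, (∀ m, f m ∈ R ∙ x) → ∀ n ∈ R ∙ x, f n = 0 := by
    intro f hf n hn
    obtain ⟨r, rfl⟩ := Submodule.mem_span_singleton.mp hn
    rw [map_smul, hcon f hf, smul_zero]
  have hK : invariantClosure (R ∙ x) ≤ ⊥ := by
    refine hsemi.2 _ (invariantClosure_isFullyInvariant _) (subProd_le_iff.mpr fun f hf => ?_)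
    obtain ⟨g, hg, hsum⟩ := hproj.exists_decomposition (ι := M →ₗ[R] M) (fun _ => R ∙ x) id f hf
    refine invariantClosure_le_comap (L := ⊥) (f := f) fun h n hn => ?_
    rw [hsum]
    refine Submodule.sum_mem _ fun i _ => ?_
    have := hzero (Finsupp.lapply (R := R) i ∘ₗ g ∘ₗ h) (fun m => hg _ i) n hn
    have h0 : g (h n) i = 0 := this
    simp [h0]
  exact hx ((Submodule.mem_bot R).mp
    (hK (le_invariantClosure _ (Submodule.mem_span_singleton_self x))))

theorem sup_isFullyInvariant {K L : Submodule R M} (hK : K.IsFullyInvariant)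
    (hL : L.IsFullyInvariant) : (K ⊔ L).IsFullyInvariant := fun f =>
  sup_le ((hK f).trans (Submodule.comap_mono le_sup_left))
    ((hL f).trans (Submodule.comap_mono le_sup_right))

/-- The m-sequence argument: `P` is maximal among fully invariant submodules avoiding a sequence `a`
that starts at `x` and has `a (n + 1) ∈ R ∙ a n`. -/
theorem IsSemiprimeModule.exists_isPrimeSub_notMem (hsemi : IsSemiprimeModule R M)
    (hproj : IsProjectiveInSigma R M) {x : M} (hx : x ≠ 0) :
    ∃ P : Submodule R M, IsPrimeSub P ∧ x ∉ P := by
  have hstep := fun (y : M) (hy : y ≠ 0) => hsemi.exists_apply_ne_zero hproj hy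
  choose! F hF hF0 using hstep
  let a : ℕ → M := fun n => (fun y => F y y)^[n] x
  have hsucc : ∀ n, a (n + 1) = F (a n) (a n) := fun n => Function.iterate_succ_apply' _ n x
  have hne : ∀ n, a n ≠ 0 := fun n => by
    induction n with
    | zero => exact hx
    | succ n ih => rw [hsucc]; exact hF0 _ ih
  have hanti : Antitone fun n => R ∙ a n := antitone_nat_of_succ_le fun n => by
    rw [Submodule.span_singleton_le_iff_mem, hsucc]
    exact hF _ (hne n) _
  obtain ⟨P, -, hP⟩ := zorn_le_nonempty₀
    {N : Submodule R M | N.IsFullyInvariant ∧ ∀ n, a n ∉ N} (by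
      intro c hc hchain y hy
      have hmem : ∀ z, z ∈ sSup c ↔ ∃ N ∈ c, z ∈ N := fun z =>
        Submodule.mem_sSup_of_directed ⟨y, hy⟩ hchain.directedOn
      refine ⟨sSup c, ⟨fun f => sSup_le fun N hN => ?_, fun n hn => ?_⟩, fun N => le_sSup⟩
      · exact ((hc hN).1 f).trans (Submodule.comap_mono (le_sSup hN))
      · obtain ⟨N, hN, hn⟩ := (hmem _).mp hn
        exact (hc hN).2 n hn) ⊥
    ⟨hsemi.1, fun n hn => hne n ((Submodule.mem_bot R).mp hn)⟩
  have hmeets : ∀ K : Submodule R M, K.IsFullyInvariant → ¬ K ≤ P → ∃ n, a n ∈ K ⊔ P := by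
    intro K hK hKP
    by_contra! hcon
    exact hKP (le_sup_left.trans
      (hP.2 (y := K ⊔ P) ⟨sup_isFullyInvariant hK hP.1.1, hcon⟩ le_sup_right))
  refine ⟨P, ⟨hP.1.1, fun K L hK hL hKL => ?_⟩, hP.1.2 0⟩
  by_contra! hcon
  obtain ⟨m, hm⟩ := hmeets K hK hcon.1
  obtain ⟨n, hn⟩ := hmeets L hL hcon.2
  have hle : ∀ {N : Submodule R M} {i j : ℕ}, i ≤ j → a i ∈ N → a j ∈ N := fun hij hi =>
    (Submodule.span_singleton_le_iff_mem _ _).mp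
      ((hanti hij).trans ((Submodule.span_singleton_le_iff_mem _ _).mpr hi))
  have hmK := hle (le_max_left m n) hm
  have hnL := hle (le_max_right m n) hn
  set k := max m n
  -- With `a k` in both `K ⊔ P` and `L ⊔ P`, splitting `F (a k)` along `L ⊔ P` forces `a (k + 1) ∈
  -- P`.
  obtain ⟨g, h, hg, hh, hgh⟩ := hproj.exists_add_of_mem_sup L P (F (a k)) fun y =>
    (Submodule.span_singleton_le_iff_mem _ _).mpr hnL (hF _ (hne k) y)
  have hgP : K ⊔ P ≤ P.comap g := sup_le (subProd_le_iff.mp hKL g hg) (hP.1.1 g)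
  refine hP.1.2 (k + 1) ?_
  rw [hsucc, hgh]
  exact add_mem (hgP hmK) (hh _)

theorem IsPrimeSub.exists_isMinimalPrimeSub_le {P : Submodule R M} (hP : IsPrimeSub P) :
    ∃ Q : Submodule R M, IsMinimalPrimeSub Q ∧ Q ≤ P := by
  obtain ⟨Q, hQP, hQ⟩ := zorn_le_nonempty₀ (α := (Submodule R M)ᵒᵈ)
    {N | IsPrimeSub (OrderDual.ofDual N)} (by
      intro c hc hchain y hy
      refine ⟨OrderDual.toDual (sInf {N | OrderDual.toDual N ∈ c}),
        ⟨fun f => ?_, fun K L hK hL hKL => ?_⟩, fun N hN => ?_⟩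
      · intro x hx
        exact Submodule.mem_sInf.mpr fun N hN => (hc hN).1 f (Submodule.mem_sInf.mp hx N hN)
      · by_contra! hcon
        obtain ⟨hKn, hLn⟩ := hcon
        simp only [OrderDual.ofDual_toDual, le_sInf_iff, not_forall] at hKn hLn
        obtain ⟨A, hA, hKA⟩ := hKn
        obtain ⟨B, hB, hLB⟩ := hLn
        obtain ⟨C, hC, hCA, hCB⟩ := hchain.directedOn _ hA _ hB
        rcases (hc hC).2 K L hK hL (hKL.trans (sInf_le hC)) with h | h
        · exact hKA (h.trans hCA)
        · exact hLB (h.trans hCB)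
      · exact sInf_le (α := Submodule R M) hN)
    (OrderDual.toDual P) hP
  exact ⟨OrderDual.ofDual Q, ⟨hQ.1, fun N hN hNQ => hQ.2 (y := OrderDual.toDual N) hN hNQ⟩, hQP⟩

theorem iInf_minimalPrimeSub_eq_bot (hproj : IsProjectiveInSigma R M)
    (hsemi : IsSemiprimeModule R M) {ι : Type*} (P : ι → Submodule R M)
    (hP : ∀ Q : Submodule R M, IsMinimalPrimeSub Q → ∃ i, P i = Q) : ⨅ i, P i = ⊥ := by
  refine (Submodule.eq_bot_iff _).mpr fun x hx => ?_
  by_contra hx0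
  obtain ⟨Q, hQ, hxQ⟩ := hsemi.exists_isPrimeSub_notMem hproj hx0
  obtain ⟨Q', hQ', hle⟩ := hQ.exists_isMinimalPrimeSub_le
  obtain ⟨i, rfl⟩ := hP Q' hQ'
  exact hxQ (hle ((Submodule.mem_iInf _).mp hx i))

theorem finset_inf_isFullyInvariant {ι : Type*} {P : ι → Submodule R M}
    (hP : ∀ i, (P i).IsFullyInvariant) (s : Finset ι) : (s.inf P).IsFullyInvariant := by
  intro f x hx
  simp only [Submodule.mem_comap, Submodule.mem_finsetInf] at hx ⊢
  exact fun i hi => hP i f (hx i hi)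

theorem IsPrimeSub.exists_le_of_finset_inf_le {ι : Type*} {P : ι → Submodule R M}
    (hP : ∀ i, (P i).IsFullyInvariant) {Q : Submodule R M} (hQ : IsPrimeSub Q) (hQtop : Q ≠ ⊤)
    (s : Finset ι) (hs : s.inf P ≤ Q) : ∃ i ∈ s, P i ≤ Q := by
  classical
  induction s using Finset.induction_on with
  | empty => exact absurd (top_le_iff.mp hs) hQtop
  | insert a s _ ih =>
    rw [Finset.inf_insert] at hs
    have hprod : subProd (P a) (s.inf P) ≤ Q :=
      (subProd_le_iff.mpr fun f hf k hk =>
        Submodule.mem_inf.mpr ⟨hP a f hk, hf k⟩).trans hs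
    rcases hQ.2 _ _ (hP a) (finset_inf_isFullyInvariant hP s) hprod with h | h
    · exact ⟨a, Finset.mem_insert_self a s, h⟩
    · obtain ⟨i, hi, hle⟩ := ih h
      exact ⟨i, Finset.mem_insert_of_mem hi, hle⟩

/-- If `Q` is prime, `L ⊓ Q = 0` and `L ≰ Q`, then `Q` consists of the elements killed by every
map `M → L`. -/
theorem IsPrimeSub.mem_iff_forall_apply_eq_zero {Q L : Submodule R M} (hQ : IsPrimeSub Q)
    (hL : L.IsFullyInvariant) (hLQ : Disjoint L Q) (hle : ¬ L ≤ Q) (x : M) :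
    x ∈ Q ↔ ∀ g : M →ₗ[R] M, (∀ m, g m ∈ L) → g x = 0 := by
  constructor
  · intro hx g hg
    exact Submodule.disjoint_def.mp hLQ _ (hg x) (hQ.1 g hx)
  · intro h
    have hprod : subProd (invariantClosure (R ∙ x)) L ≤ Q := by
      refine subProd_le_iff.mpr fun f hf => invariantClosure_le_comap fun g n hn => ?_
      obtain ⟨r, rfl⟩ := Submodule.mem_span_singleton.mp hn
      have h0 : f (g x) = 0 := h (f ∘ₗ g) fun m => hf _
      simp [h0]
    exact ((hQ.2 _ _ (invariantClosure_isFullyInvariant _) hL hprod).resolve_right hle)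
      (le_invariantClosure _ (Submodule.mem_span_singleton_self x))

end Primes

/-! ### Transfer of the chain condition. -/

section Annihilators

variable {R : Type u} [Ring R] {M : Type v} [AddCommGroup M] [Module R M]

theorem IsLeftAnnihilator.mem_iff {A : Submodule R M} (hA : IsLeftAnnihilator A) (x : M) :
    x ∈ A ↔ ∀ f : M →ₗ[R] M, (∀ y ∈ A, f y = 0) → f x = 0 := by
  constructor
  · exact fun hx f hf => hf x hx
  · obtain ⟨S, rfl⟩ := hA
    intro h
    simp only [Submodule.mem_iInf, LinearMap.mem_ker] at h ⊢
    exact fun f hf => h f fun y hy => hy f hf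

theorem isLeftAnnihilator_of_forall_mem_iff {A : Submodule R M} (S : Set (M →ₗ[R] M))
    (h : ∀ x, x ∈ A ↔ ∀ f ∈ S, f x = 0) : IsLeftAnnihilator A :=
  ⟨S, by ext x; simp [h]⟩

theorem ACCLeftAnnihilators.of_iInf_eq_bot {ι : Type*} [Finite ι] (P : ι → Submodule R M)
    (hP : ∀ i, (P i).IsFullyInvariant) (hbot : ⨅ i, P i = ⊥)
    (h : ∀ i, ACCLeftAnnihilators R (M ⧸ P i)) : ACCLeftAnnihilators R M := by
  intro a ha hann
  -- Taking all endomorphisms that vanish on `a n` makes `S` antitone, so the annihilators induced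
  -- in each quotient ascend.
  let S : ℕ → Set (M →ₗ[R] M) := fun n => {f | ∀ y ∈ a n, f y = 0}
  have hS : Antitone S := fun m n hmn f hf y hy => hf y (ha hmn hy)
  let b : ∀ i, ℕ → Submodule R (M ⧸ P i) := fun i n =>
    ⨅ g ∈ (fun f => (P i).mapQ (P i) f (hP i f)) '' S n, LinearMap.ker g
  have hb : ∀ i n x, (P i).mkQ x ∈ b i n ↔ ∀ f ∈ S n, f x ∈ P i := fun i n x => by
    simp [b]
  have hstab : ∀ i, ∃ n, ∀ m, n ≤ m → b i m = b i n := fun i =>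
    h i (b i) (fun m n hmn => biInf_mono (Set.image_mono (hS hmn))) fun n => ⟨_, rfl⟩
  choose N hN using hstab
  obtain ⟨n, hn⟩ := (Set.finite_range N).bddAbove
  refine ⟨n, fun m hm => le_antisymm (fun x hx => ?_) (ha hm)⟩
  rw [(hann n).mem_iff]
  intro f hf
  rw [← Submodule.mem_bot R, ← hbot, Submodule.mem_iInf]
  intro i
  have hle : N i ≤ n := hn ⟨i, rfl⟩
  have hx' : (P i).mkQ x ∈ b i m := (hb i m x).mpr fun g hg => by
    rw [hg x hx]; exact zero_mem _
  rw [hN i m (hle.trans hm), ← hN i n hle] at hx'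
  exact (hb i n x).mp hx' f hf

theorem ACCLeftAnnihilators.quotient (hproj : IsProjectiveInSigma R M) {Q L : Submodule R M}
    (hQ : IsPrimeSub Q) (hL : L.IsFullyInvariant) (hLQ : Disjoint L Q) (hle : ¬ L ≤ Q)
    (h : ACCLeftAnnihilators R M) : ACCLeftAnnihilators R (M ⧸ Q) := by
  intro a ha hann
  have hmem : ∀ n, IsLeftAnnihilator ((a n).comap Q.mkQ) := by
    intro n
    refine isLeftAnnihilator_of_forall_mem_iff
      {k | ∃ f g : M →ₗ[R] M, (∀ y, Q.mkQ y ∈ a n → f y ∈ Q) ∧ (∀ m, g m ∈ L) ∧ k = g ∘ₗ f}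
      fun x => ⟨?_, fun hx => ?_⟩
    · rintro hx _ ⟨f, g, hf, hg, rfl⟩
      exact (hQ.mem_iff_forall_apply_eq_zero hL hLQ hle _).mp (hf x hx) g hg
    · rw [Submodule.mem_comap, (hann n).mem_iff]
      intro f hf
      obtain ⟨f', hf'⟩ := hproj.exists_lift_quotient Q f
      rw [← hf', Submodule.mkQ_apply, Submodule.Quotient.mk_eq_zero,
        hQ.mem_iff_forall_apply_eq_zero hL hLQ hle]
      refine fun g hg => hx _ ⟨f', g, fun y hy => ?_, hg, rfl⟩
      rw [← Submodule.Quotient.mk_eq_zero, ← Submodule.mkQ_apply, hf', hf _ hy]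
  obtain ⟨n, hn⟩ := h (fun n => (a n).comap Q.mkQ) (fun m n hmn => Submodule.comap_mono (ha hmn))
    hmem
  exact ⟨n, fun m hm => Submodule.comap_injective_of_surjective Q.mkQ_surjective (hn m hm)⟩

theorem ACCLeftAnnihilators.of_subsingleton [Subsingleton M] : ACCLeftAnnihilators R M :=
  fun _ _ _ => ⟨0, fun _ _ => Subsingleton.elim _ _⟩

end Annihilators

theorem proposition2p25 {R : Type u} [Ring R] {M : Type v} [AddCommGroup M] [Module R M]
    (hproj : IsProjectiveInSigma R M) (hsemi : IsSemiprimeModule R M)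
    (t : ℕ) (P : Fin t → Submodule R M)
    (hP : ∀ Q : Submodule R M, IsMinimalPrimeSub Q ↔ ∃ i, P i = Q)
    (hdim : ∀ i, HasFiniteUniformDim R (M ⧸ P i)) :
    IsGoldieModule R M ↔ ∀ i, IsGoldieModule R (M ⧸ P i) := by
  classical
  have hmin : ∀ i, IsMinimalPrimeSub (P i) := fun i => (hP _).mpr ⟨i, rfl⟩
  have hinv : ∀ i, (P i).IsFullyInvariant := fun i => (hmin i).1.1
  have hbot : ⨅ i, P i = ⊥ := iInf_minimalPrimeSub_eq_bot hproj hsemi P fun Q => (hP Q).mp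
  constructor
  · refine fun h i => ⟨?_, hdim i⟩
    -- `IsPrimeSub` allows `⊤`.
    by_cases htop : P i = ⊤
    · have : Subsingleton (M ⧸ P i) := Submodule.Quotient.subsingleton_iff.mpr htop
      exact ACCLeftAnnihilators.of_subsingleton
    · refine h.1.quotient hproj (hmin i).1
        -- Indices are excluded by value, since `P` may repeat a prime.
        (finset_inf_isFullyInvariant hinv (Finset.univ.filter fun j => P j ≠ P i)) ?_ fun hle => ?_
      · rw [Submodule.disjoint_def]
        intro x hx hxi
        rw [← Submodule.mem_bot R, ← hbot, Submodule.mem_iInf]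
        intro j
        by_cases hj : P j = P i
        · rwa [hj]
        · exact Submodule.mem_finsetInf.mp hx j (by simpa using hj)
      · obtain ⟨j, hj, hji⟩ := (hmin i).1.exists_le_of_finset_inf_le hinv htop _ hle
        exact (Finset.mem_filter.mp hj).2 (le_antisymm hji ((hmin i).2 (hmin j).1 hji))
  · intro h
    refine ⟨ACCLeftAnnihilators.of_iInf_eq_bot P hinv hbot fun i => (h i).1, ?_⟩
    have hfin := HasFiniteUniformDim.quotient_finset_inf P hdim Finset.univ
    rw [Finset.inf_univ_eq_iInf] at hfin
    refine HasFiniteUniformDim.of_ker_inf_eq_bot (⨅ i, P i).mkQ (⨅ i, P i).mkQ ?_ hfin hfin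
    rw [Submodule.ker_mkQ, hbot]
    exact disjoint_bot_left
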